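/- Let $\mathrm{SSI}^n_{a,b}:\{0,1\}^n\times\{0,1\}^n\to\mathbb Z\cup\{?\}$ be the partial function with $\mathrm{SSI}^n_{a,b}(x,y)=|x\wedge y|$ if $|x|=a$ and $|y|=b$, and $\mathrm{SSI}^n_{a,b}(x,y)=\,?$ otherwise, where $|\cdot|$ is the Hamming weight. For a partial function $f$, let $R(f)$ be the least worst-case number of bits exchanged by a two-party protocol with public randomness that, on every input $(x,y)$ with $f(x,y)\neq\,?$, outputs $f(x,y)$ with probability at least $2/3$. Let $\mathrm{ISR}_\rho(f)$ be the same quantity for protocols in which, instead of public randomness, Alice sees $r_1,\dots,r_t$ and Bob sees $s_1,\dots,s_t$ for some finite $t$, where the pairs $(r_i,s_i)\in\{0,1\}^2$ are independent with $\Pr[r_i=s_i=0]=\Pr[r_i=s_i=1]=(1+\rho)/4$ and $\Pr[r_i=0,s_i=1]=\Pr[r_i=1,s_i=0]=(1-\rho)/4$. In the two-way model, the output is produced by one of the parties, determined by the transcript. Let $R^{1\text{-way}}$ and $\mathrm{ISR}^{1\text{-way}}_\rho$ be the corresponding quantities for protocols in which only Alice sends bits and Bob produces the output. There is an absolute constant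 $c>0$, and for every $\rho\in(0,1]$ a constant $C=C(\rho)>0$, such that for all integers $n$ and $a,b\ge 1$ with $a,b\le n/2$, $$c\max\{a,\log_2 b\}\ \le\ R^{1\text{-way}}(\mathrm{SSI}^n_{a,b})\ \le\ \mathrm{ISR}^{1\text{-way}}_\rho(\mathrm{SSI}^n_{a,b})\ \le\ C\,a\max\{1,\log_2(ab)\},$$ and, if moreover $a\le b$, $$c\max\{a,\log_2 b\}\ \le\ R(\mathrm{SSI}^n_{a,b})\ \le\ \mathrm{ISR}_\rho(\mathrm{SSI}^n_{a,b})\ \le\ C\,a\max\{1,\log_2(ab)\}.$$ -/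

import Mathlib

namespace SmallSet

/-- Deterministic two-party protocol trees. Alice's view ranges over `A`, Bob's over `B`.
At a `Sends` node one party sends one bit computed from its view (the position in the tree
encodes the transcript so far). At a leaf one party, determined by the transcript, produces the
output from its view. -/
inductive Protocol (A B Z : Type) : Type
  | aliceOutputs (out : A → Z) : Protocol A B Z
  | bobOutputs (out : B → Z) : Protocol A B Z
  | aliceSends (bit : A → Bool) (next : Bool → Protocol A B Z) : Protocol A B Z
  | bobSends (bit : B → Bool) (next : Bool → Protocol A B Z) : Protocol A B Z

namespace Protocol

variable {A B Z : Type}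

/-- The output of the protocol on a pair of views. -/
def eval : Protocol A B Z → A → B → Z
  | aliceOutputs out, α, _ => out α
  | bobOutputs out, _, β => out β
  | aliceSends bit next, α, β => (next (bit α)).eval α β
  | bobSends bit next, α, β => (next (bit β)).eval α β

/-- The worst-case number of bits exchanged. -/
def cost : Protocol A B Z → ℕ
  | aliceOutputs _ => 0
  | bobOutputs _ => 0
  | aliceSends _ next => max (next false).cost (next true).cost + 1
  | bobSends _ next => max (next false).cost (next true).cost + 1

/-- One-way protocols: only Alice sends bits, and Bob produces the output. -/
def IsOneWay : Protocol A B Z → Prop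
  | aliceOutputs _ => False
  | bobOutputs _ => True
  | aliceSends _ next => ∀ c, (next c).IsOneWay
  | bobSends _ _ => False

end Protocol

/-- The two communication models. -/
inductive CommModel : Type
  | oneWay
  | twoWay

/-- The protocols that a communication model allows. -/
def Protocol.Allowed {A B Z : Type} : CommModel → Protocol A B Z → Prop
  | .oneWay, P => P.IsOneWay
  | .twoWay, _ => True

/-- Bit strings of length `n`. -/
abbrev BitStr (n : ℕ) : Type := Fin n → Bool

/-- `P` computes the partial function `f` (`none` stands for `?`) with probability at least `2/3`
on every input, using public randomness `ω : Ω` of distribution `p`. -/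
def ComputesPublic {X Y Z Ω : Type} [DecidableEq Z] [Fintype Ω]
    (p : Ω → ℝ) (P : Protocol (X × Ω) (Y × Ω) Z) (f : X → Y → Option Z) : Prop :=
  ∀ x y z, f x y = some z →
    2 / 3 ≤ ∑ ω, if P.eval (x, ω) (y, ω) = z then p ω else 0

/-- `k` bits suffice for a public-coin protocol for `f` in the model `M`. The public random
string has an arbitrary distribution on an arbitrary finite set. -/
def PublicAchievable {X Y Z : Type} [DecidableEq Z]
    (M : CommModel) (f : X → Y → Option Z) (k : ℕ) : Prop :=
  ∃ (Ω : Type) (_ : Fintype Ω) (p : Ω → ℝ) (P : Protocol (X × Ω) (Y × Ω) Z),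
    p ∈ stdSimplex ℝ Ω ∧ P.Allowed M ∧ P.cost = k ∧ ComputesPublic p P f

/-- The doubly symmetric binary source with parameter `ρ`. -/
noncomputable def dsbs (ρ : ℝ) (r s : Bool) : ℝ :=
  if r = s then (1 + ρ) / 4 else (1 - ρ) / 4

/-- The probability that `t` independent samples of the source with parameter `ρ` give Alice the
string `r` and Bob the string `s`. -/
noncomputable def dsbsString (ρ : ℝ) {t : ℕ} (r s : BitStr t) : ℝ :=
  ∏ i, dsbs ρ (r i) (s i)

/-- `P` computes the partial function `f` with probability at least `2/3` on every input, where
Alice sees `r` and Bob sees `s` for `t` independent samples of the source with parameter `ρ`. -/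
def ComputesISR {X Y Z : Type} [DecidableEq Z] (ρ : ℝ) {t : ℕ}
    (P : Protocol (X × BitStr t) (Y × BitStr t) Z) (f : X → Y → Option Z) : Prop :=
  ∀ x y z, f x y = some z →
    2 / 3 ≤ ∑ r : BitStr t, ∑ s : BitStr t,
      if P.eval (x, r) (y, s) = z then dsbsString ρ r s else 0

/-- `k` bits suffice for a protocol for `f` in the model `M` with imperfectly shared randomness
of correlation `ρ`. -/
def ISRAchievable {X Y Z : Type} [DecidableEq Z]
    (M : CommModel) (ρ : ℝ) (f : X → Y → Option Z) (k : ℕ) : Prop :=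
  ∃ (t : ℕ) (P : Protocol (X × BitStr t) (Y × BitStr t) Z),
    P.Allowed M ∧ P.cost = k ∧ ComputesISR ρ P f

/-- Randomized communication complexity with public randomness. The set is nonempty for inputs
that are bit strings (`exists_publicAchievable`), so that this is a minimum. -/
noncomputable def randCC {X Y Z : Type} [DecidableEq Z]
    (M : CommModel) (f : X → Y → Option Z) : ℕ :=
  sInf {k | PublicAchievable M f k}

/-- Communication complexity with imperfectly shared randomness of correlation `ρ`. The set is
nonempty for inputs that are bit strings (`exists_isrAchievable`), so that this is a minimum. -/
noncomputable def isrCC {X Y Z : Type} [DecidableEq Z]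
    (M : CommModel) (ρ : ℝ) (f : X → Y → Option Z) : ℕ :=
  sInf {k | ISRAchievable M ρ f k}

/-- Hamming weight. -/
def weight {n : ℕ} (x : BitStr n) : ℕ :=
  (Finset.univ.filter fun i => x i = true).card

/-- Bitwise conjunction. -/
def bitAnd {n : ℕ} (x y : BitStr n) : BitStr n := fun i => x i && y i

/-- Small-Set-Intersection. -/
def ssi (n a b : ℕ) (x y : BitStr n) : Option ℤ :=
  if weight x = a ∧ weight y = b then some (weight (bitAnd x y) : ℤ) else none

section Attained

/-- Alice sends the listed bits of her view, then Bob outputs. -/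
def Protocol.sendBits {A B Z : Type} :
    List (A → Bool) → (List Bool → B → Z) → Protocol A B Z
  | [], out => .bobOutputs (out [])
  | m :: l, out => .aliceSends m fun c => sendBits l fun w => out (c :: w)

theorem Protocol.eval_sendBits {A B Z : Type} (l : List (A → Bool)) (out : List Bool → B → Z)
    (α : A) (β : B) : (sendBits l out).eval α β = out (l.map fun m => m α) β := by
  induction l generalizing out with
  | nil => rfl
  | cons m l ih => simp [sendBits, eval, ih]

theorem Protocol.isOneWay_sendBits {A B Z : Type} (l : List (A → Bool))
    (out : List Bool → B → Z) : (sendBits l out).IsOneWay := by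
  induction l generalizing out with
  | nil => trivial
  | cons m l ih => exact fun c => ih _

theorem exists_exact_protocol {n : ℕ} {Y Z R S : Type} [Inhabited Z]
    (M : CommModel) (f : BitStr n → Y → Option Z) :
    ∃ P : Protocol (BitStr n × R) (Y × S) Z,
      P.Allowed M ∧ ∀ x y z r s, f x y = some z → P.eval (x, r) (y, s) = z := by
  refine ⟨Protocol.sendBits (List.ofFn fun (i : Fin n) (α : BitStr n × R) => α.1 i)
    fun w β => (f (fun i => w.getD i false) β.1).getD default, ?_, ?_⟩
  · cases M
    · exact Protocol.isOneWay_sendBits _ _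
    · trivial
  · intro x y z r s h
    rw [Protocol.eval_sendBits]
    have hx : (fun i : Fin n => ((List.ofFn fun (i : Fin n) (α : BitStr n × R) => α.1 i).map
        fun m => m (x, r)).getD i false) = x := by
      funext i
      simp [List.getD_eq_getElem?_getD]
    simp only [hx, h, Option.getD_some]

theorem sum_dsbsString (ρ : ℝ) (t : ℕ) :
    ∑ r : BitStr t, ∑ s : BitStr t, dsbsString ρ r s = 1 := by
  have h : ∀ r : BitStr t, ∑ s : BitStr t, dsbsString ρ r s = ∏ i, ∑ c, dsbs ρ (r i) c := by
    intro r
    exact (Fintype.prod_sum fun i c => dsbs ρ (r i) c).symm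
  have h2 : ∀ c, ∑ d, dsbs ρ c d = 1 / 2 := by
    intro c
    cases c <;> simp [dsbs] <;> ring
  simp only [h, h2]
  simp

theorem exists_publicAchievable {n : ℕ} {Y Z : Type} [DecidableEq Z] [Inhabited Z]
    (M : CommModel) (f : BitStr n → Y → Option Z) : ∃ k, PublicAchievable M f k := by
  obtain ⟨P, hM, hP⟩ := exists_exact_protocol (R := Unit) (S := Unit) M f
  refine ⟨P.cost, Unit, inferInstance, fun _ => 1, P, ⟨by simp, by simp⟩, hM, rfl, ?_⟩
  intro x y z h
  simp only [hP x y z _ _ h]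
  norm_num

theorem exists_isrAchievable {n : ℕ} {Y Z : Type} [DecidableEq Z] [Inhabited Z]
    (M : CommModel) (ρ : ℝ) (f : BitStr n → Y → Option Z) : ∃ k, ISRAchievable M ρ f k := by
  obtain ⟨P, hM, hP⟩ := exists_exact_protocol (R := BitStr 0) (S := BitStr 0) M f
  refine ⟨P.cost, 0, P, hM, rfl, ?_⟩
  intro x y z h
  simp only [hP x y z _ _ h, if_true, sum_dsbsString]
  norm_num

end Attained

end SmallSet

/-!
*Lower bounds.* Averaged over its coins, a public-coin protocol contains a deterministic one that
agrees with the function on most pairs of inputs. Padding by common and private ones turns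
arbitrary strings into sets of prescribed sizes, and so embeds three problems into small-set
intersection: EQUALITY of two bits, INDEX with either party holding the string, and INNER PRODUCT.
For INDEX, the `m`-bit strings are approximated with constant advantage by the behaviours of the
party who holds them, and comparing exponential moments shows that `exp (Ω(m))` behaviours are
needed. Alice has at most `2 ^ k` of them in a one-way protocol of cost `k`, and Bob has
`2 ^ O(2 ^ k)`, which gives `a` when `b ≤ a`, and `log b`, respectively. When `a ≤ b`, the bound `a`
comes from INNER PRODUCT and the discrepancy of the Hadamard matrix.

*Upper bound.* Alice sends, for each of her `a` elements, the `L` samples of her randomness that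
belong to this element. Bob counts those of his elements whose own samples have correlation at
least `ρ / 2` with one of these lists; by Hoeffding's inequality and a union bound over the `a * b`
pairs of elements, `L = O(log (a * b))` samples make all the comparisons come out right.
-/

namespace SmallSet

open Finset MeasureTheory ProbabilityTheory

section Protocols

variable {A B A' B' Z Z' : Type}

namespace Protocol

/-- The protocol run by parties who compute their views in it from other views and post-process
its output. -/
def simulate (f : A' → A) (g : B' → B) (τ : Z → Z') : Protocol A B Z → Protocol A' B' Z'
  | aliceOutputs out => aliceOutputs (τ ∘ out ∘ f)
  | bobOutputs out => bobOutputs (τ ∘ out ∘ g)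
  | aliceSends bit next => aliceSends (bit ∘ f) fun c => (next c).simulate f g τ
  | bobSends bit next => bobSends (bit ∘ g) fun c => (next c).simulate f g τ

theorem eval_simulate (f : A' → A) (g : B' → B) (τ : Z → Z') (P : Protocol A B Z) (α : A')
    (β : B') : (P.simulate f g τ).eval α β = τ (P.eval (f α) (g β)) := by
  induction P with
  | aliceOutputs | bobOutputs => rfl
  | aliceSends _ _ ih | bobSends _ _ ih => exact ih _

theorem cost_simulate (f : A' → A) (g : B' → B) (τ : Z → Z') (P : Protocol A B Z) :
    (P.simulate f g τ).cost = P.cost := by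
  induction P with
  | aliceOutputs | bobOutputs => rfl
  | aliceSends _ _ ih | bobSends _ _ ih => simp only [simulate, cost, ih]

theorem IsOneWay.simulate {P : Protocol A B Z} (h : P.IsOneWay) (f : A' → A) (g : B' → B)
    (τ : Z → Z') : (P.simulate f g τ).IsOneWay := by
  induction P with
  | bobOutputs => trivial
  | aliceSends _ _ ih => exact fun c => ih c (h c)
  | aliceOutputs | bobSends => exact h

theorem Allowed.simulate {M : CommModel} {P : Protocol A B Z} (h : P.Allowed M) (f : A' → A)
    (g : B' → B) (τ : Z → Z') : (P.simulate f g τ).Allowed M :=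
  match M with
  | .oneWay => IsOneWay.simulate h f g τ
  | .twoWay => trivial

theorem IsOneWay.allowed {P : Protocol A B Z} (h : P.IsOneWay) (M : CommModel) : P.Allowed M :=
  match M with
  | .oneWay => h
  | .twoWay => trivial

theorem cost_sendBits (l : List (A → Bool)) (out : List Bool → B → Z) :
    (sendBits l out).cost = l.length := by
  induction l generalizing out with
  | nil => rfl
  | cons m l ih => simp only [sendBits, cost, ih, max_self, List.length_cons]

theorem exists_isOneWay_eval_eq_of_message {κ : Type} [Fintype κ] (msg : A → κ → Bool)
    (out : (κ → Bool) → B → Z) :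
    ∃ P : Protocol A B Z, P.IsOneWay ∧ P.cost = Fintype.card κ ∧
      ∀ α β, P.eval α β = out (msg α) β := by
  let e := Fintype.equivFin κ
  refine ⟨sendBits (List.ofFn fun i α => msg α (e.symm i))
    fun w β => out (fun k => w.getD (e k) false) β, isOneWay_sendBits _ _, ?_, fun α β => ?_⟩
  · rw [cost_sendBits, List.length_ofFn]
  · rw [eval_sendBits]
    congr 1
    funext k
    simp [List.getD_eq_getElem?_getD]

theorem encard_range_eval_aliceSends_le (bit : A → Bool) (next : Bool → Protocol A B Z) :
    (Set.range (aliceSends bit next).eval).encard ≤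
      (Set.range (next false).eval).encard + (Set.range (next true).eval).encard := by
  refine (Set.encard_le_encard ?_).trans (Set.encard_union_le _ _)
  rintro _ ⟨α, rfl⟩
  cases hc : bit α
  · exact Or.inl ⟨α, funext fun β => by rw [eval, hc]⟩
  · exact Or.inr ⟨α, funext fun β => by rw [eval, hc]⟩

theorem encard_range_flip_eval_bobSends_le (bit : B → Bool) (next : Bool → Protocol A B Z) :
    (Set.range (flip (bobSends bit next).eval)).encard ≤
      (Set.range (flip (next false).eval)).encard + (Set.range (flip (next true).eval)).encard := by
  refine (Set.encard_le_encard ?_).trans (Set.encard_union_le _ _)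
  rintro _ ⟨β, rfl⟩
  cases hc : bit β
  · exact Or.inl ⟨β, funext fun α => by simp only [flip, eval, hc]⟩
  · exact Or.inr ⟨β, funext fun α => by simp only [flip, eval, hc]⟩

theorem encard_range_flip_eval_aliceSends_le (bit : A → Bool) (next : Bool → Protocol A B Z) :
    (Set.range (flip (aliceSends bit next).eval)).encard ≤
      (Set.range (flip (next false).eval)).encard * (Set.range (flip (next true).eval)).encard := by
  let merge (p : (A → Z) × (A → Z)) (α : A) : Z := bif bit α then p.2 α else p.1 α
  rw [← Set.encard_prod]
  refine (Set.encard_le_encard ?_).trans (Set.encard_image_le merge _)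
  rintro _ ⟨β, rfl⟩
  refine ⟨(flip (next false).eval β, flip (next true).eval β), ⟨⟨β, rfl⟩, ⟨β, rfl⟩⟩, ?_⟩
  funext α
  simp only [merge, flip, eval]
  cases bit α <;> rfl

theorem IsOneWay.encard_range_eval_le {P : Protocol A B Z} (h : P.IsOneWay) :
    (Set.range P.eval).encard ≤ (2 ^ P.cost : ℕ) := by
  induction P with
  | aliceOutputs | bobSends => exact h.elim
  | bobOutputs out =>
    refine (Set.encard_le_encard (t := {out}) ?_).trans (by simp [cost])
    rintro _ ⟨α, rfl⟩
    rfl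
  | aliceSends bit next ih =>
    refine (encard_range_eval_aliceSends_le bit next).trans
      ((add_le_add (ih _ (h _)) (ih _ (h _))).trans ?_)
    rw [cost, pow_succ, mul_two]
    exact_mod_cast add_le_add (Nat.pow_le_pow_right two_pos (le_max_left _ _))
      (Nat.pow_le_pow_right two_pos (le_max_right _ _))

/-- Bob's view selects one of at most `2 ^ 2 ^ (P.cost + 1)` behaviours: the exponent counts the
nodes of the protocol tree. -/
theorem encard_range_flip_eval_le (P : Protocol A B Bool) :
    (Set.range (flip P.eval)).encard ≤ (2 ^ 2 ^ (P.cost + 1) : ℕ) := by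
  have mul_le {k l : ℕ} : 2 ^ 2 ^ (k + 1) * 2 ^ 2 ^ (l + 1) ≤ 2 ^ 2 ^ (max k l + 1 + 1) := by
    rw [← pow_add, pow_succ 2 (max k l + 1), mul_two]
    gcongr <;> simp
  have two_le (k : ℕ) : 2 ≤ 2 ^ 2 ^ (k + 1) := Nat.le_self_pow (by positivity) 2
  induction P with
  | aliceOutputs out =>
    refine (Set.encard_le_encard (t := {out}) ?_).trans (by simp [cost])
    rintro _ ⟨β, rfl⟩
    rfl
  | bobOutputs out =>
    refine (Set.encard_le_encard (t := Set.range (Function.const A)) ?_).trans ?_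
    · rintro _ ⟨β, rfl⟩
      exact ⟨out β, rfl⟩
    · rw [← Set.image_univ]
      refine (Set.encard_image_le _ _).trans ?_
      rw [Bool.univ_eq]
      exact (Set.encard_insert_le _ _).trans (by norm_num [cost])
  | aliceSends bit next ih =>
    refine (encard_range_flip_eval_aliceSends_le bit next).trans
      ((mul_le_mul' (ih _) (ih _)).trans ?_)
    exact_mod_cast mul_le
  | bobSends bit next ih =>
    refine (encard_range_flip_eval_bobSends_le bit next).trans ((add_le_add (ih _) (ih _)).trans ?_)
    exact_mod_cast (Nat.add_le_mul (two_le _) (two_le _)).trans mul_le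

end Protocol

end Protocols

section Complexity

variable {X Y Z X' Y' Z' : Type} [DecidableEq Z] [DecidableEq Z'] {M : CommModel} {ρ : ℝ} {k : ℕ}

theorem dsbs_nonneg (h0 : 0 ≤ ρ) (h1 : ρ ≤ 1) (c d : Bool) : 0 ≤ dsbs ρ c d := by
  unfold dsbs
  split_ifs <;> linarith

theorem dsbsString_nonneg (h0 : 0 ≤ ρ) (h1 : ρ ≤ 1) {t : ℕ} (r s : BitStr t) :
    0 ≤ dsbsString ρ r s :=
  prod_nonneg fun _ _ => dsbs_nonneg h0 h1 _ _

theorem ISRAchievable.publicAchievable {f : X → Y → Option Z} (h : ISRAchievable M ρ f k)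
    (h0 : 0 ≤ ρ) (h1 : ρ ≤ 1) : PublicAchievable M f k := by
  obtain ⟨t, P, hM, hk, hP⟩ := h
  refine ⟨BitStr t × BitStr t, inferInstance, fun ω => dsbsString ρ ω.1 ω.2,
    P.simulate (Prod.map id Prod.fst) (Prod.map id Prod.snd) id,
    ⟨fun ω => dsbsString_nonneg h0 h1 _ _, ?_⟩, hM.simulate _ _ _, ?_, fun x y z hz => ?_⟩
  · rw [Fintype.sum_prod_type, sum_dsbsString]
  · rw [Protocol.cost_simulate, hk]
  · simpa only [Fintype.sum_prod_type, Protocol.eval_simulate, Prod.map_apply, id_eq]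
      using hP x y z hz

theorem PublicAchievable.of_reduction {f : X → Y → Option Z} (h : PublicAchievable M f k)
    {f' : X' → Y' → Option Z'} (e : X' → X) (e' : Y' → Y) (τ : Z → Z')
    (hred : ∀ x y z', f' x y = some z' → ∃ z, f (e x) (e' y) = some z ∧ τ z = z') :
    PublicAchievable M f' k := by
  obtain ⟨Ω, _, p, P, hp, hM, hk, hP⟩ := h
  refine ⟨Ω, inferInstance, p, P.simulate (Prod.map e id) (Prod.map e' id) τ, hp,
    hM.simulate _ _ _, (Protocol.cost_simulate ..).trans hk, fun x y z' hz' => ?_⟩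
  obtain ⟨z, hz, rfl⟩ := hred x y z' hz'
  refine (hP _ _ z hz).trans (sum_le_sum fun ω _ => ?_)
  simp only [Protocol.eval_simulate, Prod.map_apply, id_eq]
  split_ifs with h₁ h₂ h₂
  · exact le_rfl
  · exact absurd (congrArg τ h₁) h₂
  · exact hp.1 ω
  · exact le_rfl

variable [Inhabited Z] {n : ℕ}

theorem randCC_le_isrCC (M : CommModel) (h0 : 0 ≤ ρ) (h1 : ρ ≤ 1)
    (f : BitStr n → Y → Option Z) : randCC M f ≤ isrCC M ρ f :=
  Nat.sInf_le (ISRAchievable.publicAchievable (Nat.sInf_mem (exists_isrAchievable M ρ f)) h0 h1)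

theorem publicAchievable_randCC (M : CommModel) (f : BitStr n → Y → Option Z) :
    PublicAchievable M f (randCC M f) :=
  Nat.sInf_mem (exists_publicAchievable M f)

end Complexity

section Averaging

/-- The sign `(-1) ^ c` of a bit; the product of two signs measures the agreement of the bits. -/
def bitSign (c : Bool) : ℝ := if c then -1 else 1

theorem bitSign_false : bitSign false = 1 := if_neg Bool.false_ne_true

theorem bitSign_true : bitSign true = -1 := if_pos rfl

theorem bitSign_mul_bitSign (c d : Bool) : bitSign c * bitSign d = if c = d then 1 else -1 := by
  cases c <;> cases d <;> norm_num [bitSign]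

theorem abs_bitSign (c : Bool) : |bitSign c| = 1 := by
  cases c <;> norm_num [bitSign]

variable {X Y : Type} {M : CommModel} {f : X → Y → Bool} {k : ℕ}

theorem one_third_le_sum_mul_bitSign {Ω : Type} [Fintype Ω] {p : Ω → ℝ}
    {P : Protocol (X × Ω) (Y × Ω) Bool} (hp : p ∈ stdSimplex ℝ Ω)
    (hP : ComputesPublic p P fun x y => some (f x y)) (x : X) (y : Y) :
    1 / 3 ≤ ∑ ω, p ω * (bitSign (P.eval (x, ω) (y, ω)) * bitSign (f x y)) := by
  have hsum : ∑ ω, p ω * (bitSign (P.eval (x, ω) (y, ω)) * bitSign (f x y)) =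
      2 * (∑ ω, if P.eval (x, ω) (y, ω) = f x y then p ω else 0) - ∑ ω, p ω := by
    rw [mul_sum, ← sum_sub_distrib]
    refine sum_congr rfl fun ω _ => ?_
    rw [bitSign_mul_bitSign]
    split_ifs <;> ring
  rw [hsum, hp.2]
  linarith [hP x y _ rfl]

theorem PublicAchievable.exists_deterministic [Fintype X] [Fintype Y]
    (h : PublicAchievable M (fun x y => some (f x y)) k) :
    ∃ D : Protocol X Y Bool, D.Allowed M ∧ D.cost = k ∧
      (Fintype.card X * Fintype.card Y / 3 : ℝ) ≤
        ∑ x, ∑ y, bitSign (D.eval x y) * bitSign (f x y) := by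
  obtain ⟨Ω, _, p, P, hp, hM, hk, hP⟩ := h
  let agreement (ω : Ω) : ℝ := ∑ x, ∑ y, bitSign (P.eval (x, ω) (y, ω)) * bitSign (f x y)
  have average : (Fintype.card X * Fintype.card Y / 3 : ℝ) ≤ ∑ ω, p ω * agreement ω := by
    calc (Fintype.card X * Fintype.card Y / 3 : ℝ)
        = ∑ _x : X, ∑ _y : Y, (1 / 3 : ℝ) := by
          simp only [sum_const, card_univ, nsmul_eq_mul]
          ring
      _ ≤ ∑ x, ∑ y, ∑ ω, p ω * (bitSign (P.eval (x, ω) (y, ω)) * bitSign (f x y)) := by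
          gcongr with x _ y _
          exact one_third_le_sum_mul_bitSign hp hP x y
      _ = ∑ ω, p ω * agreement ω := by
          simp only [agreement, mul_sum]
          rw [sum_congr rfl fun x _ => sum_comm, sum_comm]
  obtain ⟨ω, hω⟩ : ∃ ω, (Fintype.card X * Fintype.card Y / 3 : ℝ) ≤ agreement ω := by
    by_contra! hlt
    obtain ⟨ω, hω⟩ : ∃ ω, 0 < p ω := by
      by_contra! hle
      linarith [hp.2, sum_nonpos fun ω (_ : ω ∈ univ) => hle ω]
    have : ∑ ω, p ω * agreement ω <
        ∑ ω, p ω * (Fintype.card X * Fintype.card Y / 3 : ℝ) :=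
      sum_lt_sum (fun i _ => mul_le_mul_of_nonneg_left (hlt i).le (hp.1 i))
        ⟨ω, mem_univ _, mul_lt_mul_of_pos_left (hlt ω) hω⟩
    rw [← sum_mul, hp.2, one_mul] at this
    exact average.not_gt this
  refine ⟨P.simulate (·, ω) (·, ω) id, hM.simulate _ _ _,
    (Protocol.cost_simulate ..).trans hk, ?_⟩
  simpa only [Protocol.eval_simulate, id_eq] using hω

end Averaging

section Padding

variable {m n : ℕ}

theorem weight_eq_sum (x : BitStr n) : weight x = ∑ i, (x i).toNat := by
  rw [weight, card_filter]
  exact sum_congr rfl fun i _ => by cases x i <;> rfl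

theorem weight_le (x : BitStr n) : weight x ≤ n :=
  (card_le_univ _).trans_eq (Fintype.card_fin n)

theorem bitAnd_comm (x y : BitStr n) : bitAnd x y = bitAnd y x :=
  funext fun _ => Bool.and_comm _ _

theorem weight_append (x : BitStr m) (y : BitStr n) :
    weight (Fin.append x y) = weight x + weight y := by
  simp only [weight_eq_sum, Fin.sum_univ_add, Fin.append_left, Fin.append_right]

theorem bitAnd_append (x x' : BitStr m) (y y' : BitStr n) :
    bitAnd (Fin.append x y) (Fin.append x' y') = Fin.append (bitAnd x x') (bitAnd y y') := by
  funext i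
  induction i using Fin.addCases <;> simp only [bitAnd, Fin.append_left, Fin.append_right]

/-- The bit string of length `p` that starts with `q` ones and continues with zeros, used to pad
sets up to a prescribed size. It is constantly one if `p ≤ q`. -/
def onesPrefix (p q : ℕ) : BitStr p := fun i => decide (i < q)

theorem weight_onesPrefix {p q : ℕ} (h : q ≤ p) : weight (onesPrefix p q) = q := by
  simp only [weight, onesPrefix, decide_eq_true_eq, Fin.card_filter_val_lt, min_eq_right h]

theorem bitAnd_onesPrefix (p q r : ℕ) :
    bitAnd (onesPrefix p q) (onesPrefix p r) = onesPrefix p (min q r) :=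
  funext fun _ => by simp only [bitAnd, onesPrefix, lt_min_iff, Bool.decide_and]

/-- The standard basis vector at `i`, encoding the singleton `{i}`. -/
def basisStr (i : Fin m) : BitStr m := fun j => decide (j = i)

theorem weight_basisStr (i : Fin m) : weight (basisStr i) = 1 := by
  simp only [weight, basisStr, decide_eq_true_eq, filter_eq', mem_univ, if_true, card_singleton]

theorem weight_bitAnd_basisStr (u : BitStr m) (i : Fin m) :
    weight (bitAnd u (basisStr i)) = (u i).toNat := by
  rw [weight_eq_sum, sum_eq_single i (fun j _ hj => by simp [bitAnd, basisStr, hj]) (by simp)]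
  simp [bitAnd, basisStr]

variable {X Y Z : Type} [DecidableEq Z] {M : CommModel} {a b α β k : ℕ}

theorem PublicAchievable.of_ssi_of_weight_eq (h : PublicAchievable M (ssi n a b) k)
    (u : X → BitStr m) (v : Y → BitStr m) (τ : ℕ → Z) (hu : ∀ x, weight (u x) = α)
    (hv : ∀ y, weight (v y) = β) (hα : α ≤ a) (hβ : β ≤ b) (hn : m + max (a - α) (b - β) ≤ n) :
    PublicAchievable M (fun x y => some (τ (weight (bitAnd (u x) (v y))))) k := by
  obtain ⟨p, rfl⟩ := Nat.exists_eq_add_of_le ((Nat.le_add_right _ _).trans hn)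
  have hp : max (a - α) (b - β) ≤ p := Nat.add_le_add_iff_left.mp hn
  refine h.of_reduction (fun x => Fin.append (u x) (onesPrefix p (a - α)))
    (fun y => Fin.append (v y) (onesPrefix p (b - β)))
    (fun z => τ (z - min (a - α) (b - β) : ℤ).toNat) fun x y z' hz' => ?_
  refine ⟨weight (bitAnd (u x) (v y)) + min (a - α) (b - β), ?_, ?_⟩
  · have ⟨hpa, hpb⟩ := max_le_iff.mp hp
    have hwa : weight (onesPrefix p (a - α)) = a - α := weight_onesPrefix hpa
    have hwb : weight (onesPrefix p (b - β)) = b - β := weight_onesPrefix hpb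
    have hwab : weight (onesPrefix p (min (a - α) (b - β))) = min (a - α) (b - β) :=
      weight_onesPrefix (min_le_of_left_le hpa)
    rw [ssi, if_pos]
    · rw [bitAnd_append, bitAnd_onesPrefix, weight_append, hwab]
      push_cast
      rfl
    · rw [weight_append, weight_append, hwa, hwb, hu, hv]
      omega
  · rw [← Option.some.inj hz']
    simp

theorem PublicAchievable.of_ssi_of_weight_le (h : PublicAchievable M (ssi n a b) k)
    (u : X → BitStr m) (v : Y → BitStr m) (τ : ℕ → Z) (hu : ∀ x, weight (u x) ≤ α)
    (hv : ∀ y, weight (v y) ≤ β) (hα : α ≤ a) (hβ : β ≤ b)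
    (hn : m + α + β + max (a - α) (b - β) ≤ n) :
    PublicAchievable M (fun x y => some (τ (weight (bitAnd (u x) (v y))))) k := by
  have h' := h.of_ssi_of_weight_eq (m := m + (α + β))
    (fun x => Fin.append (u x) (Fin.append (onesPrefix α (α - weight (u x))) (onesPrefix β 0)))
    (fun y => Fin.append (v y) (Fin.append (onesPrefix α 0) (onesPrefix β (β - weight (v y)))))
    τ (α := α) (β := β) (fun x => ?_) (fun y => ?_) hα hβ (by omega)
  · simpa only [bitAnd_append, bitAnd_onesPrefix, weight_append, Nat.zero_min, Nat.min_zero,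
      weight_onesPrefix (Nat.zero_le _), add_zero] using h'
  · have := hu x
    simp only [weight_append, weight_onesPrefix (Nat.zero_le _),
      weight_onesPrefix (Nat.sub_le α (weight (u x)))]
    omega
  · have := hv y
    simp only [weight_append, weight_onesPrefix (Nat.zero_le _),
      weight_onesPrefix (Nat.sub_le β (weight (v y)))]
    omega

end Padding

section Index

variable {m k : ℕ} {M : CommModel}

theorem PublicAchievable.one_le_of_equality
    (h : PublicAchievable M (fun i j : Fin 2 => some (decide (j = i))) k) : 1 ≤ k := by
  obtain ⟨D, -, rfl, hD⟩ := h.exists_deterministic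
  by_contra! hcost
  suffices ∑ i, ∑ j, bitSign (D.eval i j) * bitSign (decide (j = i)) = 0 by
    rw [this, Fintype.card_fin] at hD
    norm_num at hD
  cases D with
  | aliceOutputs out | bobOutputs out =>
    simp only [Fin.sum_univ_two, Protocol.eval, Fin.isValue, decide_true, zero_ne_one, one_ne_zero,
      decide_false, bitSign_true, bitSign_false]
    ring
  | aliceSends | bobSends => exact absurd hcost (by simp [Protocol.cost])

theorem sum_exp_mul_agreement (δ : ℝ) (g : BitStr m) :
    ∑ u : BitStr m, Real.exp (δ * ∑ i, bitSign (g i) * bitSign (u i)) =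
      2 ^ m * Real.cosh δ ^ m := by
  have hbit (i : Fin m) : ∑ c, Real.exp (δ * (bitSign (g i) * bitSign c)) = 2 * Real.cosh δ := by
    rw [Fintype.sum_bool, Real.cosh_eq]
    cases g i <;> simp only [bitSign_mul_bitSign, reduceCtorEq, if_true, if_false, mul_one,
      mul_neg] <;> ring
  calc ∑ u : BitStr m, Real.exp (δ * ∑ i, bitSign (g i) * bitSign (u i))
      = ∑ u : BitStr m, ∏ i, Real.exp (δ * (bitSign (g i) * bitSign (u i))) := by
        simp only [mul_sum, Real.exp_sum]
    _ = ∏ i, ∑ c, Real.exp (δ * (bitSign (g i) * bitSign c)) :=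
        (Fintype.prod_sum fun i c => Real.exp (δ * (bitSign (g i) * bitSign c))).symm
    _ = 2 ^ m * Real.cosh δ ^ m := by
        simp only [hbit, prod_const, card_univ, Fintype.card_fin, mul_pow]

theorem exp_le_of_encard_range_le {δ : ℝ} (hδ : 0 ≤ δ) {N : ℕ} (h : BitStr m → BitStr m)
    (hcorr : 2 ^ m * (δ * m) ≤ ∑ u, ∑ i, bitSign (h u i) * bitSign (u i))
    (hN : (Set.range h).encard ≤ N) : Real.exp (δ ^ 2 / 2 * m) ≤ N := by
  let agreement (g u : BitStr m) : ℝ := ∑ i, bitSign (g i) * bitSign (u i)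
  have jensen : 2 ^ m * Real.exp (δ ^ 2 * m) ≤ ∑ u, Real.exp (δ * agreement (h u) u) := by
    have hw : ∑ _u : BitStr m, ((2 : ℝ) ^ m)⁻¹ = 1 := by simp
    have := convexOn_exp.map_sum_le (t := univ) (p := fun u => δ * agreement (h u) u)
      (fun _ _ => by positivity) hw fun _ _ => Set.mem_univ _
    simp only [smul_eq_mul, ← mul_sum] at this
    rw [← le_inv_mul_iff₀ (by positivity)]
    refine le_trans (Real.exp_le_exp.mpr ?_) this
    rw [le_inv_mul_iff₀ (by positivity)]
    linarith [mul_le_mul_of_nonneg_left hcorr hδ]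
  have union : ∑ u, Real.exp (δ * agreement (h u) u) ≤ N * (2 ^ m * Real.cosh δ ^ m) := by
    have hcard : #(univ.image h) ≤ N := by
      rwa [← Set.image_univ, ← coe_univ, ← coe_image, Set.encard_coe_eq_coe_finsetCard,
        Nat.cast_le] at hN
    calc ∑ u, Real.exp (δ * agreement (h u) u)
        ≤ ∑ u, ∑ g ∈ univ.image h, Real.exp (δ * agreement g u) :=
          sum_le_sum fun u _ => single_le_sum (f := fun g => Real.exp (δ * agreement g u))
            (fun _ _ => (Real.exp_pos _).le) (mem_image_of_mem h (mem_univ u))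
      _ = #(univ.image h) * (2 ^ m * Real.cosh δ ^ m) := by
          rw [sum_comm]
          simp only [agreement, sum_exp_mul_agreement, sum_const, nsmul_eq_mul]
      _ ≤ N * (2 ^ m * Real.cosh δ ^ m) := by gcongr
  have hcosh : Real.cosh δ ^ m ≤ Real.exp (δ ^ 2 / 2 * m) := by
    rw [mul_comm, Real.exp_nat_mul]
    exact pow_le_pow_left₀ (Real.cosh_pos δ).le (Real.cosh_le_exp_half_sq δ) m
  refine le_of_mul_le_mul_right ?_ (by positivity : 0 < 2 ^ m * Real.exp (δ ^ 2 / 2 * m))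
  calc Real.exp (δ ^ 2 / 2 * m) * (2 ^ m * Real.exp (δ ^ 2 / 2 * m))
      = 2 ^ m * Real.exp (δ ^ 2 * m) := by
        rw [mul_left_comm, ← Real.exp_add]
        ring_nf
    _ ≤ N * (2 ^ m * Real.cosh δ ^ m) := jensen.trans union
    _ ≤ N * (2 ^ m * Real.exp (δ ^ 2 / 2 * m)) := by gcongr

theorem le_of_encard_range_le_two_pow {K : ℕ} (h : BitStr m → BitStr m)
    (hcorr : (2 ^ m * m / 3 : ℝ) ≤ ∑ u, ∑ i, bitSign (h u i) * bitSign (u i))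
    (hK : (Set.range h).encard ≤ (2 ^ K : ℕ)) : m ≤ 18 * K := by
  have hexp := exp_le_of_encard_range_le (δ := 1 / 3) (by norm_num) h (by linarith) hK
  have hlog : (1 / 3) ^ 2 / 2 * (m : ℝ) ≤ K := Real.exp_le_exp.mp <| hexp.trans <| by
    rw [← Real.exp_one_pow]
    push_cast
    gcongr
    linarith [Real.add_one_le_exp (1 : ℝ)]
  exact_mod_cast (by linarith : (m : ℝ) ≤ 18 * K)

theorem PublicAchievable.le_of_index_oneWay
    (h : PublicAchievable .oneWay (fun (u : BitStr m) i => some (u i)) k) : m ≤ 18 * k := by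
  obtain ⟨D, hM, rfl, hD⟩ := h.exists_deterministic
  exact le_of_encard_range_le_two_pow D.eval (by simpa using hD)
    (Protocol.IsOneWay.encard_range_eval_le hM)

theorem PublicAchievable.le_of_index_flip
    (h : PublicAchievable M (fun i (u : BitStr m) => some (u i)) k) : m ≤ 18 * 2 ^ (k + 1) := by
  obtain ⟨D, -, rfl, hD⟩ := h.exists_deterministic
  refine le_of_encard_range_le_two_pow (flip D.eval) ?_ D.encard_range_flip_eval_le
  rw [sum_comm]
  simpa [flip, mul_comm] using hD

end Index

section Discrepancy

variable {X Y : Type*} [Fintype X] [Fintype Y] {K : X → Y → ℝ}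

/-- The real matrix `K` correlates by at most `δ` with every product of a function of the row and
a function of the column that are bounded by one. Up to normalization this is the discrepancy of
`K`, relaxed from combinatorial rectangles to bounded functions. -/
def HasDiscrepancyLE (K : X → Y → ℝ) (δ : ℝ) : Prop :=
  ∀ (f : X → ℝ) (g : Y → ℝ), (∀ x, |f x| ≤ 1) → (∀ y, |g y| ≤ 1) →
    |∑ x, ∑ y, K x y * (f x * g y)| ≤ δ

theorem sum_sq_le_card {φ : X → ℝ} (hφ : ∀ x, |φ x| ≤ 1) : ∑ x, φ x ^ 2 ≤ Fintype.card X := by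
  simpa using sum_le_sum fun x (_ : x ∈ univ) => (sq_le_one_iff_abs_le_one _).mpr (hφ x)

/-- Lindsey's lemma. -/
theorem hasDiscrepancyLE_of_orthogonal_columns [DecidableEq Y] {N : ℝ}
    (hK : ∀ y y', ∑ x, K x y * K x y' = if y = y' then N else 0) :
    HasDiscrepancyLE K √(Fintype.card X * (N * Fintype.card Y)) := fun f g hf hg => by
  refine Real.abs_le_sqrt ?_
  have hrow : ∑ x, (∑ y, K x y * g y) ^ 2 = N * ∑ y, g y ^ 2 := by
    calc ∑ x, (∑ y, K x y * g y) ^ 2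
        = ∑ x, ∑ y, ∑ y', g y * g y' * (K x y * K x y') := by
          simp only [sq, sum_mul_sum]
          exact sum_congr rfl fun x _ => sum_congr rfl fun y _ => sum_congr rfl fun y' _ => by ring
      _ = ∑ y, ∑ y', g y * g y' * ∑ x, K x y * K x y' := by
          simp only [mul_sum]
          rw [sum_comm, sum_congr rfl fun y _ => sum_comm]
      _ = N * ∑ y, g y ^ 2 := by
          simp only [hK, mul_ite, mul_zero, sum_ite_eq, mem_univ, if_true, mul_sum]
          exact sum_congr rfl fun y _ => by ring
  have hcol : N * ∑ y, g y ^ 2 ≤ N * Fintype.card Y := by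
    rcases isEmpty_or_nonempty Y with _ | ⟨⟨y⟩⟩
    · simp
    · have hN : 0 ≤ N := by
        rw [← if_pos (rfl : y = y) (c := y = y) (t := N) (e := 0), ← hK]
        exact sum_nonneg fun x _ => mul_self_nonneg _
      exact mul_le_mul_of_nonneg_left (sum_sq_le_card hg) hN
  calc (∑ x, ∑ y, K x y * (f x * g y)) ^ 2
      = (∑ x, f x * ∑ y, K x y * g y) ^ 2 := by simp only [mul_sum, mul_left_comm]
    _ ≤ (∑ x, f x ^ 2) * ∑ x, (∑ y, K x y * g y) ^ 2 := sum_mul_sq_le_sq_mul_sq _ _ _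
    _ ≤ Fintype.card X * (N * Fintype.card Y) := by
        rw [hrow]
        exact mul_le_mul (sum_sq_le_card hf) hcol (hrow ▸ sum_nonneg fun x _ => sq_nonneg _)
          (Nat.cast_nonneg _)

end Discrepancy

section ProtocolDiscrepancy

variable {X Y : Type} [Fintype X] [Fintype Y] {K : X → Y → ℝ} {δ : ℝ}

theorem HasDiscrepancyLE.mul_left (h : HasDiscrepancyLE K δ) {φ : X → ℝ} (hφ : ∀ x, |φ x| ≤ 1) :
    HasDiscrepancyLE (fun x y => K x y * φ x) δ := fun f g hf hg => by
  simpa only [mul_assoc] using h (fun x => φ x * f x) g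
    (fun x => (abs_mul _ _).trans_le (mul_le_one₀ (hφ x) (abs_nonneg _) (hf x))) hg

theorem HasDiscrepancyLE.mul_right (h : HasDiscrepancyLE K δ) {ψ : Y → ℝ} (hψ : ∀ y, |ψ y| ≤ 1) :
    HasDiscrepancyLE (fun x y => K x y * ψ y) δ := fun f g hf hg => by
  simpa only [mul_assoc, mul_left_comm (ψ _)] using h f (fun y => ψ y * g y) hf
    fun y => (abs_mul _ _).trans_le (mul_le_one₀ (hψ y) (abs_nonneg _) (hg y))

theorem abs_ite_one_zero_le_one (p : Prop) [Decidable p] : |if p then (1 : ℝ) else 0| ≤ 1 := by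
  split_ifs <;> simp

theorem HasDiscrepancyLE.abs_sum_mul_eval_le (h : HasDiscrepancyLE K δ) (P : Protocol X Y Bool) :
    |∑ x, ∑ y, K x y * bitSign (P.eval x y)| ≤ 2 ^ P.cost * δ := by
  have hδ : 0 ≤ δ := (abs_nonneg _).trans (h 0 0 (by simp) (by simp))
  have branch {k k₀ k₁ : ℕ} {s s₀ s₁ : ℝ} (hs : s = s₀ + s₁) (h₀ : |s₀| ≤ 2 ^ k₀ * δ)
      (h₁ : |s₁| ≤ 2 ^ k₁ * δ) (hk : k = max k₀ k₁ + 1) : |s| ≤ 2 ^ k * δ := by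
    calc |s| ≤ 2 ^ k₀ * δ + 2 ^ k₁ * δ := hs ▸ (abs_add_le _ _).trans (add_le_add h₀ h₁)
      _ ≤ 2 ^ max k₀ k₁ * δ + 2 ^ max k₀ k₁ * δ := by
          gcongr <;> first | exact one_le_two | simp
      _ = 2 ^ k * δ := by rw [hk, pow_succ]; ring
  induction P generalizing K with
  | aliceOutputs out =>
    simpa [Protocol.eval, Protocol.cost] using
      h (fun x => bitSign (out x)) 1 (fun x => (abs_bitSign _).le) (by simp)
  | bobOutputs out =>
    simpa [Protocol.eval, Protocol.cost] using
      h 1 (fun y => bitSign (out y)) (by simp) (fun y => (abs_bitSign _).le)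
  | aliceSends bit next ih =>
    have ih' (c : Bool) := ih c (h.mul_left fun x => abs_ite_one_zero_le_one (bit x = c))
    refine branch ?_ (ih' false) (ih' true) rfl
    simp only [← sum_add_distrib]
    refine sum_congr rfl fun x _ => sum_congr rfl fun y _ => ?_
    cases hc : bit x <;> simp [Protocol.eval, hc]
  | bobSends bit next ih =>
    have ih' (c : Bool) := ih c (h.mul_right fun y => abs_ite_one_zero_le_one (bit y = c))
    refine branch ?_ (ih' false) (ih' true) rfl
    simp only [← sum_add_distrib]
    refine sum_congr rfl fun x _ => sum_congr rfl fun y _ => ?_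
    cases hc : bit y <;> simp [Protocol.eval, hc]

end ProtocolDiscrepancy

section InnerProduct

variable {m k : ℕ} {M : CommModel}

theorem bitSign_odd_weight (x : BitStr m) :
    bitSign (decide (Odd (weight x))) = ∏ i, bitSign (x i) := by
  have hprod : ∏ i, bitSign (x i) = (-1) ^ weight x := by
    simp only [bitSign, prod_ite, prod_const, one_pow, mul_one, weight]
  rcases Nat.even_or_odd (weight x) with h | h
  · rw [hprod, h.neg_one_pow, decide_eq_false (Nat.not_odd_iff_even.mpr h), bitSign_false]
  · rw [hprod, h.neg_one_pow, decide_eq_true h, bitSign_true]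

theorem sum_bitSign_innerProduct_mul (v w : BitStr m) :
    ∑ u : BitStr m, bitSign (decide (Odd (weight (bitAnd u v)))) *
      bitSign (decide (Odd (weight (bitAnd u w)))) = if v = w then 2 ^ m else 0 := by
  have hbit (i : Fin m) :
      ∑ c, bitSign (c && v i) * bitSign (c && w i) = if v i = w i then 2 else 0 := by
    rw [Fintype.sum_bool]
    simp only [bitSign_mul_bitSign, Bool.true_and, Bool.false_and, if_true]
    split_ifs <;> norm_num
  calc ∑ u : BitStr m, bitSign (decide (Odd (weight (bitAnd u v)))) *
        bitSign (decide (Odd (weight (bitAnd u w))))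
      = ∑ u : BitStr m, ∏ i, bitSign (u i && v i) * bitSign (u i && w i) := by
        simp only [bitSign_odd_weight, bitAnd, prod_mul_distrib]
    _ = ∏ i, ∑ c, bitSign (c && v i) * bitSign (c && w i) :=
        (Fintype.prod_sum fun i c => bitSign (c && v i) * bitSign (c && w i)).symm
    _ = if v = w then 2 ^ m else 0 := by
        simp only [hbit, prod_ite_zero, mem_univ, true_imp_iff, prod_const, card_univ,
          Fintype.card_fin, funext_iff]

theorem PublicAchievable.le_of_innerProduct
    (h : PublicAchievable M
      (fun u v : BitStr m => some (decide (Odd (weight (bitAnd u v))))) k) : m ≤ 2 * k + 4 := by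
  obtain ⟨D, -, rfl, hD⟩ := h.exists_deterministic
  have hdisc : 2 ^ m * 2 ^ m / 3 ≤ 2 ^ D.cost * √(2 ^ m * (2 ^ m * 2 ^ m)) := by
    have := hasDiscrepancyLE_of_orthogonal_columns sum_bitSign_innerProduct_mul
      |>.abs_sum_mul_eval_le D
    simp only [Fintype.card_pi, Fintype.card_bool, prod_const, card_univ, Fintype.card_fin,
      Nat.cast_pow, Nat.cast_ofNat, mul_comm (bitSign (decide (Odd _)))] at this hD
    exact hD.trans ((le_abs_self _).trans this)
  have hsq : (2 ^ m) ^ 3 * 2 ^ m ≤ (2 ^ m) ^ 3 * (9 * (2 ^ D.cost) ^ 2 : ℝ) := by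
    have := pow_le_pow_left₀ (by positivity) hdisc 2
    rw [mul_pow, Real.sq_sqrt (by positivity)] at this
    linarith
  have hpow : (2 : ℝ) ^ m ≤ 2 ^ (2 * D.cost + 4) := by
    rw [pow_add, pow_mul']
    linarith [le_of_mul_le_mul_left hsq (by positivity), sq_nonneg ((2 : ℝ) ^ D.cost)]
  exact (pow_le_pow_iff_right₀ one_lt_two).mp hpow

end InnerProduct

section LowerBound

variable {M : CommModel} {n a b : ℕ}

theorem one_le_randCC_ssi (ha : 1 ≤ a) (hb : 1 ≤ b) (han : 2 * a ≤ n) (hbn : 2 * b ≤ n) :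
    1 ≤ randCC M (ssi n a b) := by
  have hequality := (publicAchievable_randCC M (ssi n a b)).of_ssi_of_weight_eq (m := 2)
    basisStr basisStr (fun w => decide (w = 1)) weight_basisStr weight_basisStr ha hb (by omega)
  simp only [weight_bitAnd_basisStr, Bool.toNat_eq_one, Bool.decide_eq_true] at hequality
  exact hequality.one_le_of_equality

theorem le_mul_randCC_oneWay_ssi (ha : 1 ≤ a) (hb : 1 ≤ b) (hba : b ≤ a) (han : 2 * a ≤ n) :
    a ≤ 37 * randCC .oneWay (ssi n a b) := by
  have hpos := one_le_randCC_ssi (M := .oneWay) ha hb han (by omega)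
  have hindex := (publicAchievable_randCC .oneWay (ssi n a b)).of_ssi_of_weight_le (m := a / 2)
    id basisStr (fun w => decide (w = 1)) weight_le (fun i => (weight_basisStr i).le)
    (Nat.div_le_self a 2) hb (by omega)
  simp only [weight_bitAnd_basisStr, Bool.toNat_eq_one, Bool.decide_eq_true] at hindex
  have := hindex.le_of_index_oneWay
  omega

theorem le_mul_randCC_ssi (ha : 1 ≤ a) (hab : a ≤ b) (hbn : 2 * b ≤ n) :
    a ≤ 13 * randCC M (ssi n a b) := by
  have hpos := one_le_randCC_ssi (M := M) ha (ha.trans hab) (by omega) hbn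
  have hinner := (publicAchievable_randCC M (ssi n a b)).of_ssi_of_weight_le (m := a / 2)
    id id (fun w => decide (Odd w)) weight_le weight_le (Nat.div_le_self a 2)
    ((Nat.div_le_self a 2).trans hab) (by omega)
  have := hinner.le_of_innerProduct
  omega

theorem logb_le_mul_randCC_ssi (ha : 1 ≤ a) (hab : a ≤ b) (hbn : 2 * b ≤ n) :
    Real.logb 2 b ≤ 9 * randCC M (ssi n a b) := by
  have hpos := one_le_randCC_ssi (M := M) ha (ha.trans hab) (by omega) hbn
  have hindex := (publicAchievable_randCC M (ssi n a b)).of_ssi_of_weight_le (m := b / 2)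
    basisStr id (fun w => decide (w = 1)) (fun i => (weight_basisStr i).le) weight_le ha
    (Nat.div_le_self b 2) (by omega)
  simp only [bitAnd_comm (basisStr _), weight_bitAnd_basisStr, Bool.toNat_eq_one,
    Bool.decide_eq_true] at hindex
  have hb : b ≤ 2 ^ (randCC M (ssi n a b) + 8) := by
    have hle := hindex.le_of_index_flip
    rw [pow_succ] at hle
    have := Nat.one_le_two_pow (n := randCC M (ssi n a b))
    rw [pow_add]
    omega
  rw [Real.logb_le_iff_le_rpow one_lt_two (by exact_mod_cast ha.trans hab)]
  calc (b : ℝ) ≤ 2 ^ (9 * randCC M (ssi n a b)) := by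
        exact_mod_cast hb.trans (Nat.pow_le_pow_right two_pos (by omega))
    _ = 2 ^ (9 * randCC M (ssi n a b) : ℝ) := by exact_mod_cast (Real.rpow_natCast 2 _).symm

theorem max_le_mul_randCC_ssi (ha : 1 ≤ a) (hab : a ≤ b) (hbn : 2 * b ≤ n) :
    max (a : ℝ) (Real.logb 2 b) ≤ 37 * randCC M (ssi n a b) := by
  have hle : (a : ℝ) ≤ 13 * randCC M (ssi n a b) := by exact_mod_cast le_mul_randCC_ssi ha hab hbn
  have hlog := logb_le_mul_randCC_ssi (M := M) ha hab hbn
  exact max_le (by linarith) (by linarith)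

theorem max_le_mul_randCC_oneWay_ssi (ha : 1 ≤ a) (hb : 1 ≤ b) (han : 2 * a ≤ n)
    (hbn : 2 * b ≤ n) : max (a : ℝ) (Real.logb 2 b) ≤ 37 * randCC .oneWay (ssi n a b) := by
  rcases le_total a b with hab | hba
  · exact max_le_mul_randCC_ssi ha hab hbn
  · have hlog : Real.logb 2 b ≤ a := by
      rw [Real.logb_le_iff_le_rpow one_lt_two (by exact_mod_cast hb), Real.rpow_natCast]
      exact_mod_cast hba.trans Nat.lt_two_pow_self.le
    rw [max_eq_left hlog]
    exact_mod_cast le_mul_randCC_oneWay_ssi ha hb hba han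

end LowerBound

section CorrelatedSource

variable {ρ : ℝ}

/-- The doubly symmetric binary source as a measure; a probability measure for `0 ≤ ρ ≤ 1`. -/
noncomputable def dsbsMeasure (ρ : ℝ) : Measure (Bool × Bool) :=
  ∑ q, ENNReal.ofReal (dsbs ρ q.1 q.2) • Measure.dirac q

theorem dsbsMeasure_singleton (ρ : ℝ) (q : Bool × Bool) :
    dsbsMeasure ρ {q} = ENNReal.ofReal (dsbs ρ q.1 q.2) := by
  rw [dsbsMeasure, Measure.finsetSum_apply, sum_eq_single q (fun q' _ hq => by simp [hq]) (by simp)]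
  simp

theorem isProbabilityMeasure_dsbsMeasure (h0 : 0 ≤ ρ) (h1 : ρ ≤ 1) :
    IsProbabilityMeasure (dsbsMeasure ρ) where
  measure_univ := by
    rw [← coe_univ, ← sum_measure_singleton]
    simp only [dsbsMeasure_singleton]
    rw [← ENNReal.ofReal_sum_of_nonneg fun q _ => dsbs_nonneg h0 h1 q.1 q.2, ENNReal.ofReal_eq_one]
    simp only [Fintype.sum_prod_type, Fintype.sum_bool, dsbs, if_true, Bool.true_eq_false,
      Bool.false_eq_true, if_false]
    ring

theorem dsbsMeasure_real_singleton (h0 : 0 ≤ ρ) (h1 : ρ ≤ 1) (q : Bool × Bool) :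
    (dsbsMeasure ρ).real {q} = dsbs ρ q.1 q.2 := by
  rw [measureReal_def, dsbsMeasure_singleton, ENNReal.toReal_ofReal (dsbs_nonneg h0 h1 _ _)]

theorem integral_dsbsMeasure (h0 : 0 ≤ ρ) (h1 : ρ ≤ 1) (g : Bool → Bool → ℝ) :
    ∫ q, g q.1 q.2 ∂dsbsMeasure ρ =
      (1 + ρ) / 4 * (g true true + g false false) +
        (1 - ρ) / 4 * (g true false + g false true) := by
  have := isProbabilityMeasure_dsbsMeasure h0 h1
  rw [integral_fintype .of_finite]
  simp only [dsbsMeasure_real_singleton h0 h1, smul_eq_mul, Fintype.sum_prod_type,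
    Fintype.sum_bool, dsbs, if_true, Bool.true_eq_false, Bool.false_eq_true, if_false]
  ring

theorem integral_bitSign_mul_bitSign (h0 : 0 ≤ ρ) (h1 : ρ ≤ 1) {n : ℕ} (i j : Fin n) :
    ∫ ω, bitSign (ω i).1 * bitSign (ω j).2 ∂(Measure.pi fun _ : Fin n => dsbsMeasure ρ) =
      if i = j then ρ else 0 := by
  have := isProbabilityMeasure_dsbsMeasure h0 h1
  split_ifs with hij
  · subst hij
    rw [integral_comp_eval (μ := fun _ => dsbsMeasure ρ) (i := i)
      (f := fun q => bitSign q.1 * bitSign q.2) (measurable_of_finite _).aestronglyMeasurable,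
      integral_dsbsMeasure h0 h1 fun c d => bitSign c * bitSign d]
    simp only [bitSign_mul_bitSign, if_true, reduceCtorEq, if_false]
    ring
  · have hindep := (iIndepFun_pi (μ := fun _ : Fin n => dsbsMeasure ρ) (X := fun _ => id)
      fun _ => aemeasurable_id).indepFun hij
    have hmean : ∫ q, bitSign q.1 ∂dsbsMeasure ρ = 0 := by
      rw [integral_dsbsMeasure h0 h1 fun c _ => bitSign c, bitSign_true, bitSign_false]
      ring
    have hprod := hindep.integral_fun_comp_mul_comp (f := fun q => bitSign q.1)
      (g := fun q => bitSign q.2) (measurable_pi_apply i).aemeasurable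
      (measurable_pi_apply j).aemeasurable (measurable_of_finite _).aestronglyMeasurable
      (measurable_of_finite _).aestronglyMeasurable
    have hmean' := integral_comp_eval (μ := fun _ => dsbsMeasure ρ) (i := i)
      (f := fun q => bitSign q.1) (measurable_of_finite _).aestronglyMeasurable
    simp only [id_eq] at hprod
    rw [hprod, hmean', hmean, zero_mul]

end CorrelatedSource

section Hoeffding

theorem measureReal_pi_sum_ge_le {Ω : Type*} [MeasurableSpace Ω] (μ : Measure Ω)
    [IsProbabilityMeasure μ] {X : Ω → ℝ} (hX : Measurable X) (hb : ∀ ω, X ω ∈ Set.Icc (-1) 1)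
    {θ : ℝ} (hθ : 0 ≤ θ) (L : ℕ) :
    (Measure.pi fun _ : Fin L => μ).real {ω | L * (∫ x, X x ∂μ + θ) ≤ ∑ l, X (ω l)} ≤
      Real.exp (-(θ ^ 2 / 2) * L) := by
  have hindep := iIndepFun_pi (μ := fun _ : Fin L => μ) (X := fun _ x => X x - ∫ x, X x ∂μ)
    fun _ => (hX.sub_const _).aemeasurable
  have hsub (l : Fin L) : HasSubgaussianMGF (fun ω : Fin L → Ω => X (ω l) - ∫ x, X x ∂μ) 1
      (Measure.pi fun _ : Fin L => μ) := by
    have := hasSubgaussianMGF_of_mem_Icc (μ := Measure.pi fun _ : Fin L => μ)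
      (X := fun ω => X (ω l)) (hX.comp (measurable_pi_apply l)).aemeasurable
      (.of_forall fun ω => hb (ω l))
    rw [integral_comp_eval (μ := fun _ => μ) hX.aestronglyMeasurable] at this
    convert this
    ext
    norm_num
  convert HasSubgaussianMGF.measure_sum_ge_le_of_iIndepFun hindep (s := univ) (fun l _ => hsub l)
    (ε := L * θ) (by positivity) using 3
  · ext ω
    simp only [sum_sub_distrib, sum_const, card_univ, Fintype.card_fin,
      nsmul_eq_mul, mul_add, le_sub_iff_add_le']
  · rcases eq_or_ne (L : ℝ) 0 with hL | hL
    · simp [hL]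
    · simp only [sum_const, card_univ, Fintype.card_fin, nsmul_eq_mul, NNReal.coe_mul,
        NNReal.coe_natCast, NNReal.coe_one]
      field_simp

end Hoeffding

section CorrelationTest

variable {ρ : ℝ} {n L : ℕ}

/-- The test by which Bob decides whether two samples of length `L` were drawn in the same
coordinate, where their mean correlation is `ρ`, or in different coordinates, where it is `0`. -/
def Correlated (ρ : ℝ) (u v : BitStr L) : Prop :=
  L * (ρ / 2) ≤ ∑ l, bitSign (u l) * bitSign (v l)

theorem measureReal_correlated_iff_eq_compl_le (h0 : 0 ≤ ρ) (h1 : ρ ≤ 1) (L : ℕ) (i j : Fin n) :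
    (Measure.pi fun _ : Fin L => Measure.pi fun _ : Fin n => dsbsMeasure ρ).real
      {ω | Correlated ρ (fun l => (ω l i).1) (fun l => (ω l j).2) ↔ i = j}ᶜ ≤
        Real.exp (-(ρ ^ 2 / 8) * L) := by
  have := isProbabilityMeasure_dsbsMeasure h0 h1
  let X (ω : Fin n → Bool × Bool) : ℝ := bitSign (ω i).1 * bitSign (ω j).2
  have hX : Measurable X := measurable_of_finite X
  have hmem (ω : Fin n → Bool × Bool) : X ω ∈ Set.Icc (-1) 1 :=
    abs_le.mp (by rw [abs_mul, abs_bitSign, abs_bitSign, one_mul])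
  have hmean := integral_bitSign_mul_bitSign h0 h1 i j
  rw [show -(ρ ^ 2 / 8) * L = -((ρ / 2) ^ 2 / 2) * L by ring]
  by_cases hij : i = j
  · rw [if_pos hij] at hmean
    have hneg (ω : Fin n → Bool × Bool) : -X ω ∈ Set.Icc (-1) 1 :=
      ⟨neg_le_neg (hmem ω).2, neg_le.mp (hmem ω).1⟩
    refine (measureReal_mono fun ω hω => ?_).trans
      (measureReal_pi_sum_ge_le _ hX.neg hneg (div_nonneg h0 zero_le_two) L)
    simp only [hij, iff_true, Set.mem_compl_iff, Set.mem_ofPred_eq, Correlated, not_le] at hω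
    simp only [Set.mem_ofPred_eq, Pi.neg_apply, integral_neg, sum_neg_distrib, X, hmean]
    simp only [hij]
    linarith
  · rw [if_neg hij] at hmean
    refine (measureReal_mono fun ω hω => ?_).trans
      (measureReal_pi_sum_ge_le _ hX hmem (div_nonneg h0 zero_le_two) L)
    simp only [hij, iff_false, Set.mem_compl_iff, Set.mem_ofPred_eq, not_not, Correlated] at hω
    simpa only [Set.mem_ofPred_eq, X, hmean, zero_add] using hω

variable {X Y Z : Type} [DecidableEq Z] {M : CommModel}

theorem ISRAchievable.of_measureReal (h0 : 0 ≤ ρ) (h1 : ρ ≤ 1) {f : X → Y → Option Z}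
    {P : Protocol (X × (Fin L → BitStr n)) (Y × (Fin L → BitStr n)) Z} (hM : P.Allowed M)
    (hP : ∀ x y z, f x y = some z → 2 / 3 ≤
      (Measure.pi fun _ : Fin L => Measure.pi fun _ : Fin n => dsbsMeasure ρ).real
        {ω | P.eval (x, fun l i => (ω l i).1) (y, fun l i => (ω l i).2) = z}) :
    ISRAchievable M ρ f P.cost := by
  have := isProbabilityMeasure_dsbsMeasure h0 h1
  let e : (Fin L → BitStr n) ≃ BitStr (L * n) :=
    (Equiv.curry ..).symm.trans (finProdFinEquiv.arrowCongr (.refl Bool))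
  let pair : (Fin L → Fin n → Bool × Bool) ≃ BitStr (L * n) × BitStr (L * n) :=
    { toFun ω := (e fun l i => (ω l i).1, e fun l i => (ω l i).2)
      invFun rs l i := (e.symm rs.1 l i, e.symm rs.2 l i)
      left_inv ω := by simp
      right_inv rs := by simp }
  refine ⟨L * n, P.simulate (Prod.map id e.symm) (Prod.map id e.symm) id, hM.simulate _ _ _,
    Protocol.cost_simulate .., fun x y z hz => (hP x y z hz).trans_eq ?_⟩
  classical
  have hsingleton (ω : Fin L → Fin n → Bool × Bool) :
      (Measure.pi fun _ : Fin L => Measure.pi fun _ : Fin n => dsbsMeasure ρ).real {ω} =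
        dsbsString ρ (pair ω).1 (pair ω).2 := by
    simp only [measureReal_def, Measure.pi_singleton, ENNReal.toReal_prod]
    simp only [← measureReal_def, dsbsMeasure_real_singleton h0 h1, dsbsString,
      ← finProdFinEquiv.prod_comp, Fintype.prod_prod_type]
    simp [pair, e]
  calc (Measure.pi fun _ : Fin L => Measure.pi fun _ : Fin n => dsbsMeasure ρ).real
        {ω | P.eval (x, fun l i => (ω l i).1) (y, fun l i => (ω l i).2) = z}
      = ∑ ω, if P.eval (x, fun l i => (ω l i).1) (y, fun l i => (ω l i).2) = z then
          dsbsString ρ (pair ω).1 (pair ω).2 else 0 := by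
        rw [← sum_filter, ← sum_congr rfl fun ω _ => hsingleton ω, sum_measureReal_singleton,
          coe_filter_univ]
    _ = _ := by
        rw [← Fintype.sum_prod_type', ← pair.sum_comp]
        simp [Protocol.eval_simulate, pair]

end CorrelationTest

section UpperBound

variable {n a L : ℕ} {ρ : ℝ}

open Classical in
/-- Bob's estimate of the size of the intersection of his set `y` with a set of size `a`, from a
message `w` that lists Alice's samples in the coordinates of her elements. -/
noncomputable def intersectionEstimate (ρ : ℝ) (w : Fin a × Fin L → Bool) (y : BitStr n)
    (s : Fin L → BitStr n) : ℕ :=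
  #{j | y j = true ∧ ∃ k, Correlated ρ (fun l => w (k, l)) (fun l => s l j)}

/-- Alice's samples in the coordinates of the elements of her set `x`, if this has size `a`. -/
def sketch (a : ℕ) (x : BitStr n) (r : Fin L → BitStr n) (q : Fin a × Fin L) : Bool :=
  if h : #{i | x i = true} = a then r q.2 (orderEmbOfFin {i | x i = true} h q.1) else false

theorem intersectionEstimate_sketch {x y : BitStr n} (hx : weight x = a) {r s : Fin L → BitStr n}
    (hrs : ∀ i j, x i = true → y j = true →
      (Correlated ρ (fun l => r l i) (fun l => s l j) ↔ i = j)) :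
    intersectionEstimate ρ (sketch a x r) y s = weight (bitAnd x y) := by
  unfold intersectionEstimate weight
  congr 1
  ext j
  simp only [mem_filter, mem_univ, true_and, bitAnd, Bool.and_eq_true, and_comm (a := x j = true)]
  refine and_congr_right fun hj => ?_
  have hcard : #{i | x i = true} = a := hx
  have hrange (i : Fin n) : (∃ k, orderEmbOfFin {i | x i = true} hcard k = i) ↔ x i = true := by
    rw [← Set.mem_range, range_orderEmbOfFin, mem_coe, mem_filter_univ]
  simp only [sketch, dif_pos hcard]
  constructor
  · rintro ⟨k, hk⟩
    have hxk := (hrange _).mp ⟨k, rfl⟩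
    rwa [(hrs _ j hxk hj).mp hk] at hxk
  · intro hxj
    obtain ⟨k, hk⟩ := (hrange j).mpr hxj
    refine ⟨k, ?_⟩
    rw [hk]
    exact (hrs j j hxj hj).mpr rfl

theorem isrAchievable_ssi (M : CommModel) (h0 : 0 ≤ ρ) (h1 : ρ ≤ 1) {b : ℕ}
    (hL : a * b * Real.exp (-(ρ ^ 2 / 8) * L) ≤ 1 / 3) :
    ISRAchievable M ρ (ssi n a b) (a * L) := by
  have := isProbabilityMeasure_dsbsMeasure h0 h1
  obtain ⟨P, hM, hcost, hP⟩ := Protocol.exists_isOneWay_eval_eq_of_message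
    (fun v : BitStr n × (Fin L → BitStr n) => sketch a v.1 v.2)
    (fun w (v : BitStr n × (Fin L → BitStr n)) => (intersectionEstimate ρ w v.1 v.2 : ℤ))
  rw [Fintype.card_prod, Fintype.card_fin, Fintype.card_fin] at hcost
  refine hcost ▸ ISRAchievable.of_measureReal h0 h1 (hM.allowed M) fun x y z hz => ?_
  obtain ⟨⟨hx, hy⟩, rfl⟩ : (weight x = a ∧ weight y = b) ∧ (weight (bitAnd x y) : ℤ) = z := by
    simpa only [ssi, Option.ite_none_right_eq_some, Option.some.injEq] using hz
  let μ := Measure.pi fun _ : Fin L => Measure.pi fun _ : Fin n => dsbsMeasure ρ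
  let correct (q : Fin n × Fin n) : Set (Fin L → Fin n → Bool × Bool) :=
    {ω | Correlated ρ (fun l => (ω l q.1).1) (fun l => (ω l q.2).2) ↔ q.1 = q.2}
  let pairs : Finset (Fin n × Fin n) := univ.filter (x · = true) ×ˢ univ.filter (y · = true)
  have herror : μ.real (⋃ q ∈ pairs, (correct q)ᶜ) ≤ 1 / 3 := by
    calc μ.real (⋃ q ∈ pairs, (correct q)ᶜ)
        ≤ ∑ q ∈ pairs, μ.real (correct q)ᶜ := measureReal_biUnion_finset_le _ _
      _ ≤ ∑ _q ∈ pairs, Real.exp (-(ρ ^ 2 / 8) * L) :=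
          sum_le_sum fun q _ => measureReal_correlated_iff_eq_compl_le h0 h1 L q.1 q.2
      _ = a * b * Real.exp (-(ρ ^ 2 / 8) * L) := by
          rw [sum_const, card_product, ← weight, ← weight, hx, hy, nsmul_eq_mul, Nat.cast_mul]
      _ ≤ 1 / 3 := hL
  calc (2 / 3 : ℝ) ≤ 1 - μ.real (⋃ q ∈ pairs, (correct q)ᶜ) := by linarith
    _ = μ.real (⋃ q ∈ pairs, (correct q)ᶜ)ᶜ :=
        (probReal_compl_eq_one_sub (Set.toFinite _).measurableSet).symm
    _ ≤ _ := measureReal_mono fun ω hω => ?_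
  simp only [Set.compl_iUnion, compl_compl, Set.mem_iInter] at hω
  have hest := intersectionEstimate_sketch (ρ := ρ) (y := y) hx (r := fun l i => (ω l i).1)
    (s := fun l i => (ω l i).2) fun i j hi hj => hω (i, j) <|
      mem_product.mpr ⟨(mem_filter_univ i).mpr hi, (mem_filter_univ j).mpr hj⟩
  rw [Set.mem_ofPred_eq, hP]
  exact congrArg Nat.cast hest

theorem log_three_mul_le_three_mul_max_one_logb_two {t : ℝ} (ht : 1 ≤ t) :
    Real.log (3 * t) ≤ 3 * max 1 (Real.logb 2 t) := by
  have hlog3 : Real.log 3 ≤ 2 :=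
    (Real.log_le_sub_one_of_pos three_pos).trans_eq (by norm_num)
  have hlog : Real.log t ≤ Real.logb 2 t := by
    rw [Real.logb, le_div_iff₀ (Real.log_pos one_lt_two)]
    exact mul_le_of_le_one_right (Real.log_nonneg ht) (Real.log_two_lt_d9.le.trans (by norm_num))
  rw [Real.log_mul three_ne_zero (by positivity)]
  linarith [le_max_left 1 (Real.logb 2 t), le_max_right 1 (Real.logb 2 t)]

theorem mul_exp_neg_mul_le_one_div {δ m t s : ℝ} (hδ : 0 < δ) (hm : 0 < m) (ht : 0 < t)
    (hs : Real.log (m * t) / δ ≤ s) : t * Real.exp (-δ * s) ≤ 1 / m := by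
  have hexp : Real.exp (-δ * s) ≤ (m * t)⁻¹ := by
    rw [← Real.exp_log (mul_pos hm ht), ← Real.exp_neg, Real.exp_le_exp]
    linarith [(div_le_iff₀' hδ).mp hs]
  calc t * Real.exp (-δ * s) ≤ t * (m * t)⁻¹ := by gcongr
    _ = 1 / m := by field_simp

theorem isrCC_ssi_le (M : CommModel) (h0 : 0 < ρ) (h1 : ρ ≤ 1) {b : ℕ} (ha : 1 ≤ a)
    (hb : 1 ≤ b) :
    (isrCC M ρ (ssi n a b) : ℝ) ≤ (24 / ρ ^ 2 + 1) * (a * max 1 (Real.logb 2 (a * b))) := by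
  have hab : (1 : ℝ) ≤ a * b := by exact_mod_cast one_le_mul_of_one_le_of_one_le ha hb
  have hlog := log_three_mul_le_three_mul_max_one_logb_two hab
  set W := max 1 (Real.logb 2 (a * b))
  set L := ⌈Real.log (3 * (a * b)) / (ρ ^ 2 / 8)⌉₊
  have hcost : isrCC M ρ (ssi n a b) ≤ a * L :=
    Nat.sInf_le <| isrAchievable_ssi M h0.le h1 <|
      mul_exp_neg_mul_le_one_div (by positivity) three_pos (by positivity) (Nat.le_ceil _)
  have hL : (L : ℝ) ≤ (24 / ρ ^ 2 + 1) * W :=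
    calc (L : ℝ) ≤ Real.log (3 * (a * b)) / (ρ ^ 2 / 8) + 1 :=
          (Nat.ceil_lt_add_one (div_nonneg (Real.log_nonneg (by linarith)) (by positivity))).le
      _ ≤ 3 * W / (ρ ^ 2 / 8) + W := by
          gcongr
          exact le_max_left _ _
      _ = (24 / ρ ^ 2 + 1) * W := by ring
  calc (isrCC M ρ (ssi n a b) : ℝ) ≤ a * L := by exact_mod_cast hcost
    _ ≤ a * ((24 / ρ ^ 2 + 1) * W) := by gcongr
    _ = (24 / ρ ^ 2 + 1) * (a * W) := by ring

end UpperBound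

end SmallSet

theorem mainTheorem9 :
    ∃ c : ℝ, 0 < c ∧ ∀ ρ : ℝ, 0 < ρ → ρ ≤ 1 →
      ∃ C : ℝ, 0 < C ∧ ∀ n a b : ℕ, 1 ≤ a → 1 ≤ b →
        (a : ℝ) ≤ (n : ℝ) / 2 → (b : ℝ) ≤ (n : ℝ) / 2 →
        (c * max (a : ℝ) (Real.logb 2 b) ≤ SmallSet.randCC .oneWay (SmallSet.ssi n a b) ∧
          SmallSet.randCC .oneWay (SmallSet.ssi n a b) ≤
            SmallSet.isrCC .oneWay ρ (SmallSet.ssi n a b) ∧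
          (SmallSet.isrCC .oneWay ρ (SmallSet.ssi n a b) : ℝ) ≤
            C * (a * max 1 (Real.logb 2 (a * b)))) ∧
        (a ≤ b →
          c * max (a : ℝ) (Real.logb 2 b) ≤ SmallSet.randCC .twoWay (SmallSet.ssi n a b) ∧
          SmallSet.randCC .twoWay (SmallSet.ssi n a b) ≤
            SmallSet.isrCC .twoWay ρ (SmallSet.ssi n a b) ∧
          (SmallSet.isrCC .twoWay ρ (SmallSet.ssi n a b) : ℝ) ≤
            C * (a * max 1 (Real.logb 2 (a * b)))) := by
  refine ⟨1 / 37, by norm_num, fun ρ h0 h1 => ⟨24 / ρ ^ 2 + 1, by positivity, ?_⟩⟩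
  intro n a b ha hb han hbn
  have han' : 2 * a ≤ n := by exact_mod_cast (le_div_iff₀' two_pos).mp han
  have hbn' : 2 * b ≤ n := by exact_mod_cast (le_div_iff₀' two_pos).mp hbn
  have lower_oneWay := SmallSet.max_le_mul_randCC_oneWay_ssi ha hb han' hbn'
  have middle M := SmallSet.randCC_le_isrCC M h0.le h1 (SmallSet.ssi n a b)
  have upper M := SmallSet.isrCC_ssi_le (n := n) M h0 h1 ha hb
  refine ⟨⟨by linarith, middle .oneWay, upper .oneWay⟩, fun hab => ?_⟩
  have lower_twoWay := SmallSet.max_le_mul_randCC_ssi (M := .twoWay) ha hab hbn'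
  exact ⟨by linarith, middle .twoWay, upper .twoWay⟩
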